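/- Let $0<q<1$. Let $C(SU_q(2))$ be the universal unital $C^*$-algebra generated by elements $u_{ij}$, $1\le i,j\le 2$, subject to the relations $$\sum_{k}u_{ik}u_{jk}^*=\delta_{ij},\qquad \sum_k u_{ki}^*u_{kj}=\delta_{ij},\qquad \sum_{i_1,i_2}E_{i_1i_2}u_{j_1i_1}u_{j_2i_2}=E_{j_1j_2},$$ where $E_{11}=E_{22}=0$, $E_{12}=1$, $E_{21}=-q$, and let $u_q=(u_{ij})\in M_2(C(SU_q(2)))$ be its fundamental unitary. Let $\{e_{n,m}:n\in\mathbb Z,\ m\in\mathbb N\}$, $\mathbb N=\{0,1,2,\dots\}$, be the standard orthonormal basis of $\ell^2(\mathbb Z)\otimes\ell^2(\mathbb N)$. Let $t$ be the unitary $te_n=e_{n-1}$ on $\ell^2(\mathbb Z)$; on $\ell^2(\mathbb N)$ let $Se_m=e_{m-1}$ for $m\ge1$, $Se_0=0$, let $Ne_m=me_m$, and put $p=1-S^*S$. Let $\chi_{s_1}:C(SU_q(2))\to B(\ell^2(\mathbb Z)\otimes\ell^2(\mathbb N))$ be the representation $$\chi_{s_1}(u_{11})=t^*\otimes\sqrt{1-q^{2N+2}}\,S,\quad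 \chi_{s_1}(u_{12})=-t^*\otimes q^{N+1},\quad \chi_{s_1}(u_{21})=t\otimes q^{N},\quad \chi_{s_1}(u_{22})=t\otimes S^*\sqrt{1-q^{2N+2}}.$$ For $k\in\mathbb Z$ let $P_k$ be the orthogonal projection onto the closed span of $\{e_{n,m}:n+m\le k\}$ and let $F_k=2P_k-1$. Then for every integer $k$ the triple $(\chi_{s_1},\ \ell^2(\mathbb Z)\otimes\ell^2(\mathbb N),\ F_k)$ is an odd Fredholm module for $C(SU_q(2))$, that is, $F_k=F_k^*$, $F_k^2=1$ and $[F_k,\chi_{s_1}(a)]$ is compact for all $a\in C(SU_q(2))$. For a unitary $U\in M_n(C(SU_q(2)))$ let $\langle [U],F_k\rangle$ be the Fredholm index ($\dim\ker-\dim\operatorname{coker}$) of the compression of $\chi_{s_1}(U)$ to $n$ copies of the range of $P_k$. Then 1. this compression is Fredholm for $U=u_q$, and $\langle[u_q],F_k\rangle=-1$; 2. $t\otimes p+1-1\otimes p$ is the image under $\chi_{s_1}$ of a unitary $v\in C(SU_q(2))$ whose compression is Fredholm, and $\langle[v],F_k\rangle=-1$. -/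

import Mathlib

open scoped ENNReal lp

noncomputable section

namespace QuantumSU2

/-! ### The universal C⋆-algebra `C(SU_q(2))` -/

/-- The coefficients `E_{i j}`: `E_{1 1} = E_{2 2} = 0`, `E_{1 2} = 1`, `E_{2 1} = -q`. -/
def detCoeff (q : ℝ) : Matrix (Fin 2) (Fin 2) ℂ := !![0, 1; -(q : ℂ), 0]

/-- The defining relations of `C(SU_q(2))` for a `2 × 2` matrix `u` over a C⋆-algebra:
`u` is unitary, and `∑ E_{i₁ i₂} u_{j₁ i₁} u_{j₂ i₂} = E_{j₁ j₂}` for all `j₁, j₂`. -/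
structure IsSUq2Matrix (q : ℝ) {B : Type*} [CStarAlgebra B] (u : Matrix (Fin 2) (Fin 2) B) :
    Prop where
  row : ∀ i j, ∑ k, u i k * star (u j k) = if i = j then 1 else 0
  col : ∀ i j, ∑ k, star (u k i) * u k j = if i = j then 1 else 0
  det : ∀ j₁ j₂, ∑ i₁, ∑ i₂, detCoeff q i₁ i₂ • (u j₁ i₁ * u j₂ i₂) = detCoeff q j₁ j₂ • (1 : B)

/-- A nonzero unital C⋆-algebra together with a matrix satisfying the relations. -/
structure Realization (q : ℝ) : Type 1 where
  B : Type
  [cstar : CStarAlgebra B]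
  [nontriv : Nontrivial B]
  u : Matrix (Fin 2) (Fin 2) B
  rel : IsSUq2Matrix q u

attribute [instance] Realization.cstar Realization.nontriv

/-- The C⋆-algebraic product of all realizations. -/
abbrev Ambient (q : ℝ) : Type 1 := lp (fun ρ : Realization q => ρ.B) ∞

instance ambientCStarAlgebra (q : ℝ) : CStarAlgebra (Ambient q) where
  toNormedRing := lp.inftyNormedRing
  toStarRing := lp.inftyStarRing
  toCompleteSpace := inferInstance
  toCStarRing := lp.inftyCStarRing
  toNormedAlgebra := lp.inftyNormedAlgebra
  toStarModule := inferInstance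

open scoped CStarAlgebra in
theorem IsSUq2Matrix.norm_entry_le {q : ℝ} {B : Type*} [CStarAlgebra B]
    {u : Matrix (Fin 2) (Fin 2) B} (h : IsSUq2Matrix q u) (i j : Fin 2) : ‖u i j‖ ≤ 1 := by
  let _ := CStarAlgebra.spectralOrder B
  have := CStarAlgebra.spectralOrderedRing B
  have h1 := h.col j j
  have h2 : star (u i j) * u i j ≤ 1 := by
    rw [if_pos rfl] at h1
    rw [← h1]
    exact Finset.single_le_sum (f := fun k => star (u k j) * u k j)
      (fun k _ => star_mul_self_nonneg _) (Finset.mem_univ i)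
  have h3 := CStarAlgebra.norm_le_norm_of_nonneg_of_le (star_mul_self_nonneg _) h2
  rw [CStarRing.norm_star_mul_self] at h3
  rcases subsingleton_or_nontrivial B with hB | hB
  · rw [Subsingleton.elim (u i j) 0]; simp
  · rw [CStarRing.norm_one] at h3
    nlinarith [norm_nonneg (u i j)]

/-- The canonical generators in the product of all realizations. -/
def ambientGen (q : ℝ) (i j : Fin 2) : Ambient q :=
  ⟨fun ρ => ρ.u i j, memℓp_infty ⟨1, by rintro _ ⟨ρ, rfl⟩; exact ρ.rel.norm_entry_le i j⟩⟩

/-- The closed unital star subalgebra generated by the canonical generators. -/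
def subalg (q : ℝ) : StarSubalgebra ℂ (Ambient q) :=
  (StarAlgebra.adjoin ℂ
    (Set.range fun ij : Fin 2 × Fin 2 => ambientGen q ij.1 ij.2)).topologicalClosure

/-- `C(SU_q(2))`, the universal unital C⋆-algebra generated by the entries of a `2 × 2` matrix
subject to `IsSUq2Matrix q`. It is realized as the closed star subalgebra that the generators
span in the product of all realizations, so that its norm is the largest C⋆-seminorm. -/
def CSUq2 (q : ℝ) : Type 1 := subalg q

instance isClosed_subalg (q : ℝ) : IsClosed (subalg q : Set (Ambient q)) :=
  StarSubalgebra.isClosed_topologicalClosure _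

instance cstarAlgebraCSUq2 (q : ℝ) : CStarAlgebra (CSUq2 q) :=
  StarSubalgebra.cstarAlgebra (subalg q)

/-- The generators `u_{ij}` of `C(SU_q(2))`. -/
def gen (q : ℝ) : Matrix (Fin 2) (Fin 2) (CSUq2 q) := fun i j =>
  ⟨ambientGen q i j, StarSubalgebra.le_topologicalClosure _
    (StarAlgebra.subset_adjoin ℂ _ ⟨(i, j), rfl⟩)⟩

/-- Evaluation at one realization. -/
def evalHom {q : ℝ} (ρ : Realization q) : CSUq2 q →⋆ₐ[ℂ] ρ.B where
  toFun a := a.1 ρ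
  map_one' := rfl
  map_mul' _ _ := rfl
  map_zero' := rfl
  map_add' _ _ := rfl
  commutes' _ := rfl
  map_star' _ := rfl

theorem ext_evalHom {q : ℝ} {a b : CSUq2 q} (h : ∀ ρ, evalHom ρ a = evalHom ρ b) : a = b :=
  Subtype.ext (lp.ext (funext h))

theorem evalHom_gen {q : ℝ} (ρ : Realization q) (i j : Fin 2) :
    evalHom ρ (gen q i j) = ρ.u i j := rfl

theorem isSUq2Matrix_gen (q : ℝ) : IsSUq2Matrix q (gen q) where
  row i j := ext_evalHom fun ρ => by
    rw [map_sum, apply_ite (evalHom ρ), map_one, map_zero, ← ρ.rel.row i j]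
    simp only [map_mul, map_star, evalHom_gen]
  col i j := ext_evalHom fun ρ => by
    rw [map_sum, apply_ite (evalHom ρ), map_one, map_zero, ← ρ.rel.col i j]
    simp only [map_mul, map_star, evalHom_gen]
  det i j := ext_evalHom fun ρ => by
    rw [map_sum, map_smul, map_one, ← ρ.rel.det i j]
    simp only [map_sum, map_smul, map_mul, evalHom_gen]

/-- The universal property: a matrix satisfying the relations in a nonzero C⋆-algebra induces a
unital star homomorphism. -/
def lift {q : ℝ} {B : Type} [CStarAlgebra B] [Nontrivial B] (u : Matrix (Fin 2) (Fin 2) B)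
    (hu : IsSUq2Matrix q u) : CSUq2 q →⋆ₐ[ℂ] B :=
  evalHom ⟨B, u, hu⟩

theorem lift_gen {q : ℝ} {B : Type} [CStarAlgebra B] [Nontrivial B]
    (u : Matrix (Fin 2) (Fin 2) B) (hu : IsSUq2Matrix q u) (i j : Fin 2) :
    lift u hu (gen q i j) = u i j := rfl

/-- The fundamental unitary `u_q = (u_{ij})`. -/
def fundamentalUnitary (q : ℝ) : unitary (Matrix (Fin 2) (Fin 2) (CSUq2 q)) :=
  ⟨gen q, by
    rw [Unitary.mem_iff]
    constructor
    · ext1 i j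
      exact ((isSUq2Matrix_gen q).col i j).trans (Matrix.one_apply).symm
    · ext1 i j
      exact ((isSUq2Matrix_gen q).row i j).trans (Matrix.one_apply).symm⟩

/-! ### Operators on `ℓ²(ℤ) ⊗ ℓ²(ℕ) = ℓ²(ℤ × ℕ)` -/

/-- The Hilbert space `ℓ²(ℤ) ⊗ ℓ²(ℕ)`, with orthonormal basis indexed by `ℤ × ℕ`. -/
abbrev Hil : Type := ℓ²(ℤ × ℕ, ℂ)

/-- The basis vector `e_{n,m} = e_n ⊗ e_m`. -/
def e (n : ℤ) (m : ℕ) : Hil := lp.single 2 (n, m) (1 : ℂ)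

/-- The contraction `(T x)(i) = w i * x (g i)`, for `|w| ≤ 1` and `g` injective. -/
def weightedComp (w : ℤ × ℕ → ℂ) (hw : ∀ i, ‖w i‖ ≤ 1) (g : ℤ × ℕ → ℤ × ℕ)
    (hg : Function.Injective g) : Hil →L[ℂ] Hil :=
  have key : ∀ x : Hil, ∀ i, ‖w i * x (g i)‖ ^ (2 : ℝ≥0∞).toReal ≤
      ‖x (g i)‖ ^ (2 : ℝ≥0∞).toReal := fun x i => by
    refine Real.rpow_le_rpow (norm_nonneg _) ?_ (by simp)
    rw [norm_mul]
    exact mul_le_of_le_one_left (norm_nonneg _) (hw i)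
  have hs : ∀ x : Hil, Summable fun i => ‖x i‖ ^ (2 : ℝ≥0∞).toReal := fun x =>
    (lp.memℓp x).summable (by simp)
  have hsum : ∀ x : Hil, Summable fun i => ‖w i * x (g i)‖ ^ (2 : ℝ≥0∞).toReal := fun x =>
    Summable.of_nonneg_of_le (fun i => by positivity) (key x) ((hs x).comp_injective hg)
  LinearMap.mkContinuous
    { toFun := fun x => ⟨fun i => w i * x (g i), memℓp_gen (hsum x)⟩
      map_add' := fun x y => by
        ext i
        exact mul_add _ _ _
      map_smul' := fun c x => by
        ext i
        exact mul_left_comm _ _ _ }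
    1 fun x => by
      rw [one_mul]
      refine lp.norm_le_of_tsum_le (by simp) (norm_nonneg _) ?_
      rw [lp.norm_rpow_eq_tsum (by simp) x]
      exact (Summable.tsum_le_tsum (key x) (hsum x) ((hs x).comp_injective hg)).trans
        (((hs x).comp_injective hg).tsum_le_tsum_of_inj g hg (fun _ _ => by positivity)
          (fun _ => le_rfl) (hs x))

theorem weightedComp_apply (w : ℤ × ℕ → ℂ) (hw : ∀ i, ‖w i‖ ≤ 1) (g : ℤ × ℕ → ℤ × ℕ)
    (hg : Function.Injective g) (x : Hil) (i : ℤ × ℕ) :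
    weightedComp w hw g hg x i = w i * x (g i) := rfl

/-- `t ⊗ 1`, where `t e_n = e_{n-1}`. -/
def tOp : Hil →L[ℂ] Hil :=
  weightedComp (fun _ => 1) (fun _ => by simp) (fun i => (i.1 + 1, i.2))
    (fun i j h => by
      rw [Prod.mk.injEq] at h
      exact Prod.ext (add_right_cancel h.1) h.2)

/-- `1 ⊗ S`, where `S e_m = e_{m-1}` and `S e_0 = 0`. -/
def SOp : Hil →L[ℂ] Hil :=
  weightedComp (fun _ => 1) (fun _ => by simp) (fun i => (i.1, i.2 + 1))
    (fun i j h => by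
      rw [Prod.mk.injEq] at h
      exact Prod.ext h.1 (add_right_cancel h.2))

/-- `1 ⊗ f(N)`, where `f(N) e_m = f(m) e_m`. -/
def diagOp (f : ℕ → ℝ) (hf : ∀ m, |f m| ≤ 1) : Hil →L[ℂ] Hil :=
  weightedComp (fun i => (f i.2 : ℂ)) (fun i => by simpa using hf i.2) id Function.injective_id

theorem abs_pow_le {q : ℝ} (hq : q ∈ Set.Ioo (0 : ℝ) 1) (m : ℕ) : |q ^ m| ≤ 1 := by
  rw [abs_of_nonneg (pow_nonneg hq.1.le m)]
  exact pow_le_one₀ hq.1.le hq.2.le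

theorem abs_sqrt_le {q : ℝ} (hq : q ∈ Set.Ioo (0 : ℝ) 1) (m : ℕ) :
    |Real.sqrt (1 - q ^ (2 * m + 2))| ≤ 1 := by
  rw [abs_of_nonneg (Real.sqrt_nonneg _), Real.sqrt_le_one]
  linarith [pow_nonneg hq.1.le (2 * m + 2)]

/-- `1 ⊗ q^N`. -/
def qN {q : ℝ} (hq : q ∈ Set.Ioo (0 : ℝ) 1) : Hil →L[ℂ] Hil :=
  diagOp (fun m => q ^ m) (abs_pow_le hq)

/-- `1 ⊗ q^{N+1}`. -/
def qN1 {q : ℝ} (hq : q ∈ Set.Ioo (0 : ℝ) 1) : Hil →L[ℂ] Hil :=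
  diagOp (fun m => q ^ (m + 1)) (fun m => abs_pow_le hq (m + 1))

/-- `1 ⊗ √(1 - q^{2N+2})`. -/
def rootN {q : ℝ} (hq : q ∈ Set.Ioo (0 : ℝ) 1) : Hil →L[ℂ] Hil :=
  diagOp (fun m => Real.sqrt (1 - q ^ (2 * m + 2))) (abs_sqrt_le hq)

/-- The images of the generators under `χ_{s₁}`, that is, of `τ_t * π_{s₁}` with
`τ_t(u) = diag(t̄, t)`:
`u₁₁ ↦ t̄ ⊗ √(1-q^{2N+2}) S`, `u₁₂ ↦ - t̄ ⊗ q^{N+1}`,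
`u₂₁ ↦ t ⊗ q^N`, `u₂₂ ↦ t ⊗ S⋆ √(1-q^{2N+2})`. -/
def chiMatrix {q : ℝ} (hq : q ∈ Set.Ioo (0 : ℝ) 1) : Matrix (Fin 2) (Fin 2) (Hil →L[ℂ] Hil) :=
  !![star tOp * (rootN hq * SOp), -(star tOp * qN1 hq);
     tOp * qN hq, tOp * (star SOp * rootN hq)]

theorem tOp_apply (x : Hil) (n : ℤ) (m : ℕ) : tOp x (n, m) = x (n + 1, m) := one_mul _

theorem SOp_apply (x : Hil) (n : ℤ) (m : ℕ) : SOp x (n, m) = x (n, m + 1) := one_mul _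

theorem diagOp_apply (f : ℕ → ℝ) (hf : ∀ m, |f m| ≤ 1) (x : Hil) (n : ℤ) (m : ℕ) :
    diagOp f hf x (n, m) = (f m : ℂ) * x (n, m) := rfl

theorem inner_e (n : ℤ) (m : ℕ) (x : Hil) : inner ℂ (e n m) x = x (n, m) := by
  rw [e, lp.inner_single_left]
  simp

theorem e_apply (n n' : ℤ) (m m' : ℕ) :
    e n m (n', m') = if n' = n ∧ m' = m then 1 else 0 := by
  rw [e, lp.single_apply, Pi.single_apply]
  simp

theorem star_apply (T : Hil →L[ℂ] Hil) (x : Hil) (n : ℤ) (m : ℕ) :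
    star T x (n, m) = inner ℂ (T (e n m)) x := by
  rw [← inner_e, ContinuousLinearMap.star_eq_adjoint, ContinuousLinearMap.adjoint_inner_right]

theorem tOp_e (n : ℤ) (m : ℕ) : tOp (e n m) = e (n - 1) m := by
  ext ⟨n', m'⟩
  rw [tOp_apply, e_apply, e_apply]
  simp only [eq_sub_iff_add_eq]

theorem SOp_e_zero (n : ℤ) : SOp (e n 0) = 0 := by
  ext ⟨n', m'⟩
  rw [SOp_apply, e_apply]
  simp

theorem SOp_e_succ (n : ℤ) (m : ℕ) : SOp (e n (m + 1)) = e n m := by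
  ext ⟨n', m'⟩
  rw [SOp_apply, e_apply, e_apply]
  simp

theorem diagOp_e (f : ℕ → ℝ) (hf : ∀ m, |f m| ≤ 1) (n : ℤ) (m : ℕ) :
    diagOp f hf (e n m) = (f m : ℂ) • e n m := by
  ext ⟨n', m'⟩
  rw [diagOp_apply, lp.coeFn_smul, Pi.smul_apply, e_apply]
  split_ifs with h
  · rw [h.2, smul_eq_mul]
  · simp

theorem star_tOp_apply (x : Hil) (n : ℤ) (m : ℕ) : star tOp x (n, m) = x (n - 1, m) := by
  rw [star_apply, tOp_e, inner_e]

theorem star_SOp_apply_zero (x : Hil) (n : ℤ) : star SOp x (n, 0) = 0 := by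
  rw [star_apply, SOp_e_zero, inner_zero_left]

theorem star_SOp_apply_succ (x : Hil) (n : ℤ) (m : ℕ) : star SOp x (n, m + 1) = x (n, m) := by
  rw [star_apply, SOp_e_succ, inner_e]

theorem star_diagOp (f : ℕ → ℝ) (hf : ∀ m, |f m| ≤ 1) : star (diagOp f hf) = diagOp f hf := by
  ext x ⟨n, m⟩
  rw [star_apply, diagOp_e, inner_smul_left, inner_e, diagOp_apply, Complex.conj_ofReal]

theorem hil_smul_apply (c : ℂ) (x : Hil) (i : ℤ × ℕ) : (c • x) i = c * x i := rfl

theorem hil_neg_apply (x : Hil) (i : ℤ × ℕ) : (-x) i = -x i := rfl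

theorem hil_add_apply (x y : Hil) (i : ℤ × ℕ) : (x + y) i = x i + y i := rfl

theorem root_mul {q : ℝ} (hq : q ∈ Set.Ioo (0 : ℝ) 1) (m : ℕ) (z : ℂ) :
    ((Real.sqrt (1 - q ^ (2 * m + 2)) : ℝ) : ℂ) *
      (((Real.sqrt (1 - q ^ (2 * m + 2)) : ℝ) : ℂ) * z) = (1 - (q : ℂ) ^ (2 * m + 2)) * z := by
  rw [← mul_assoc, ← Complex.ofReal_mul, Real.mul_self_sqrt]
  · push_cast; rfl
  · linarith [pow_le_one₀ hq.1.le hq.2.le (n := 2 * m + 2)]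

theorem root_mul_zero {q : ℝ} (hq : q ∈ Set.Ioo (0 : ℝ) 1) (z : ℂ) :
    ((Real.sqrt (1 - q ^ 2) : ℝ) : ℂ) * (((Real.sqrt (1 - q ^ 2) : ℝ) : ℂ) * z) =
      (1 - (q : ℂ) ^ 2) * z := by
  simpa using root_mul hq 0 z

set_option maxHeartbeats 2000000 in
theorem isSUq2Matrix_chiMatrix {q : ℝ} (hq : q ∈ Set.Ioo (0 : ℝ) 1) :
    IsSUq2Matrix q (chiMatrix hq) := by
  constructor
  · intro i j
    ext x ⟨n, m⟩
    fin_cases i <;> fin_cases j <;> rcases m with _ | m <;>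
    simp [chiMatrix, Fin.sum_univ_two, tOp_apply, SOp_apply, qN, qN1, rootN, diagOp_apply,
      star_tOp_apply, star_SOp_apply_zero, star_SOp_apply_succ, star_diagOp, root_mul hq,
      root_mul_zero hq] <;> ring
  · intro i j
    ext x ⟨n, m⟩
    fin_cases i <;> fin_cases j <;> rcases m with _ | m <;>
    simp [chiMatrix, Fin.sum_univ_two, tOp_apply, SOp_apply, qN, qN1, rootN, diagOp_apply,
      star_tOp_apply, star_SOp_apply_zero, star_SOp_apply_succ, star_diagOp, root_mul hq,
      root_mul_zero hq] <;> ring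
  · intro i j
    ext x ⟨n, m⟩
    fin_cases i <;> fin_cases j <;> rcases m with _ | m <;>
    simp [chiMatrix, Fin.sum_univ_two, tOp_apply, SOp_apply, qN, qN1, rootN, diagOp_apply,
      star_tOp_apply, star_SOp_apply_zero, star_SOp_apply_succ, star_diagOp, root_mul hq,
      root_mul_zero hq, detCoeff,
      hil_smul_apply, hil_neg_apply, hil_add_apply, -lp.coeFn_smul, -lp.coeFn_neg, -lp.coeFn_add,
      -Complex.coe_smul] <;> ring

theorem e_ne_zero (n : ℤ) (m : ℕ) : e n m ≠ 0 := fun h => by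
  have h1 := e_apply n n m m
  rw [h, if_pos ⟨rfl, rfl⟩] at h1
  exact zero_ne_one h1

instance nontrivialHil : Nontrivial Hil := ⟨e 0 0, 0, e_ne_zero 0 0⟩

/-- The representation `χ_{s₁}` of `C(SU_q(2))` on `ℓ²(ℤ) ⊗ ℓ²(ℕ)`. -/
def chi {q : ℝ} (hq : q ∈ Set.Ioo (0 : ℝ) 1) : CSUq2 q →⋆ₐ[ℂ] (Hil →L[ℂ] Hil) :=
  lift (chiMatrix hq) (isSUq2Matrix_chiMatrix hq)

/-- `1 ⊗ p` with `p = 1 - S⋆ S`. -/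
def pOp : Hil →L[ℂ] Hil := 1 - star SOp * SOp

/-- `P_k`, the orthogonal projection onto the closed span of `{e_{n,m} : n + m ≤ k}`. -/
def P (k : ℤ) : Hil →L[ℂ] Hil :=
  (Submodule.span ℂ {x : Hil | ∃ (n : ℤ) (m : ℕ), n + m ≤ k ∧ x = e n m}).topologicalClosure
    |>.starProjection

/-- `F_k = 2 P_k - 1`. -/
def F (k : ℤ) : Hil →L[ℂ] Hil := (2 : ℂ) • P k - 1

/-! ### Odd Fredholm modules and the index pairing -/

section Fredholm

variable {A : Type*} [CStarAlgebra A]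
  {H : Type*} [NormedAddCommGroup H] [InnerProductSpace ℂ H] [CompleteSpace H]

/-- `(π, H, G)` is an odd Fredholm module over `A`: `G` is a self-adjoint unitary on `H` and
`[G, π(a)]` is compact for every `a`. -/
structure IsOddFredholmModule (π : A →⋆ₐ[ℂ] (H →L[ℂ] H)) (G : H →L[ℂ] H) : Prop where
  selfAdjoint : IsSelfAdjoint G
  sq_eq_one : G * G = 1
  compact_commutator : ∀ a, IsCompactOperator (G * π a - π a * G)

/-- The `+1`-eigenspace of `G`. For a self-adjoint unitary `G` this is the range of the
projection `(1 + G) / 2`. -/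
abbrev posSpace (G : H →L[ℂ] H) : Submodule ℂ H := LinearMap.ker (G - 1 : H →L[ℂ] H).toLinearMap

instance completeSpace_posSpace (G : H →L[ℂ] H) : CompleteSpace (posSpace G) :=
  ContinuousLinearMap.completeSpace_ker (G - 1)

/-- The compression of `π(U)`, for a unitary matrix `U` over `A`, to the direct sum of `n` copies
of the positive space of `G`: with `E` the orthogonal projection onto that space, the entries
are `E π(U_{ij}) E`. -/
def compression (π : A →⋆ₐ[ℂ] (H →L[ℂ] H)) (G : H →L[ℂ] H) {n : ℕ}
    (U : unitary (Matrix (Fin n) (Fin n) A)) :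
    (Fin n → posSpace G) →L[ℂ] (Fin n → posSpace G) :=
  ContinuousLinearMap.pi fun i => ∑ j,
    ((posSpace G).orthogonalProjectionOnto ∘L π (U.1 i j) ∘L (posSpace G).subtypeL) ∘L
      ContinuousLinearMap.proj j

/-- The index `dim ker T - dim coker T`. -/
def fredholmIndex {V : Type*} [AddCommGroup V] [Module ℂ V] [TopologicalSpace V]
    (T : V →L[ℂ] V) : ℤ :=
  (Module.finrank ℂ (LinearMap.ker T.toLinearMap) : ℤ) -
    Module.finrank ℂ (V ⧸ LinearMap.range T.toLinearMap)

/-- The index pairing `⟨[U], G⟩`, the Fredholm index of the compression of `π(U)` to the positive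
space of `G`. -/
def indexPairing (π : A →⋆ₐ[ℂ] (H →L[ℂ] H)) (G : H →L[ℂ] H) {n : ℕ}
    (U : unitary (Matrix (Fin n) (Fin n) A)) : ℤ :=
  fredholmIndex (compression π G U)

end Fredholm

end QuantumSU2

end

/-!
Every operator at hand is a weighted shift in the basis `e_{n,m}`. It commutes with `F_k` except
on the two antidiagonals `n + m = k, k + 1`, where the weights of `u₁₂` and `u₂₁` decay like
`q ^ m`, so its commutator with `F_k` is compact.

Let `T`, `S` be the compressions of a unitary `U` and of `U⋆`. Then `1 - S T` is the compression of
`U⋆ (1 - P_k) U`, likewise for `1 - T S`, and both turn out to be diagonal. For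
`u_q` their nonzero entries, in the second copy and for `n + m = k`, are `q ^ (2 m + 2)` and
`q ^ (2 m)`; for `v` the first operator vanishes and the second one has a single entry `1`, at
`(k, 0)`. In both cases `T` is injective and its range is the hyperplane of the vectors whose
coordinate at `(k, 0)` in the last copy is zero.

Finally `v = c r + 1 - r`, where `c = u₂₁` and `r` is the limit of the powers of `c⋆ c`: under
`χ_{s₁}` this is `lim q ^ (2 j N) = p`.
-/

namespace QuantumSU2

theorem isFredholm_of_range_eq_ker {𝕜 V W : Type*} [NontriviallyNormedField 𝕜] [CompleteSpace 𝕜]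
    [NormedAddCommGroup V] [NormedSpace 𝕜 V] [CompleteSpace V] [NormedAddCommGroup W]
    [NormedSpace 𝕜 W] [FiniteDimensional 𝕜 W] {T : V →L[𝕜] V} {φ : V →L[𝕜] W}
    (hT : Function.Injective T) (hφ : Function.Surjective φ) (h : T.range = φ.ker) :
    T.IsFredholm := by
  have hclosed : IsClosed (T.range : Set V) := h ▸ φ.isClosed_ker
  have hker : T.ker = ⊥ := LinearMap.ker_eq_bot.2 hT
  obtain ⟨_, hK⟩ := T.antilipschitz_of_injective_of_isClosed_range hT hclosed
  have eqv : (V ⧸ T.range) ≃ₗ[𝕜] W :=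
    (Submodule.quotEquivOfEq _ _ h).trans (φ.toLinearMap.quotKerEquivOfSurjective hφ)
  exact ⟨(hK.isEmbedding T.continuous).isStrictMap, hclosed, hker ▸ inferInstance,
    Module.Finite.equiv eqv.symm, hker ▸ Submodule.closedComplemented_bot⟩

theorem fredholmIndex_of_range_eq_ker {V W : Type*} [AddCommGroup V] [Module ℂ V]
    [TopologicalSpace V] [AddCommGroup W] [Module ℂ W] {T : V →L[ℂ] V} {φ : V →ₗ[ℂ] W}
    (hT : Function.Injective T) (hφ : Function.Surjective φ)
    (h : LinearMap.range T.toLinearMap = LinearMap.ker φ) :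
    fredholmIndex T = -Module.finrank ℂ W := by
  have eqv := (Submodule.quotEquivOfEq _ _ h).trans (φ.quotKerEquivOfSurjective hφ)
  rw [fredholmIndex, LinearMap.ker_eq_bot.2 hT, finrank_bot, eqv.finrank_eq, Nat.cast_zero,
    zero_sub]

theorem posSpace_two_smul_starProjection_sub_one {H : Type*} [NormedAddCommGroup H]
    [InnerProductSpace ℂ H] (K : Submodule ℂ H) [K.HasOrthogonalProjection] :
    posSpace ((2 : ℂ) • K.starProjection - 1) = K := by
  ext x
  have h : ((2 : ℂ) • K.starProjection - 1 - 1) x = (2 : ℂ) • (K.starProjection x - x) := by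
    change (2 : ℂ) • K.starProjection x - x - x = _
    module
  rw [LinearMap.mem_ker, ContinuousLinearMap.coe_coe, h, smul_eq_zero_iff_right two_ne_zero,
    sub_eq_zero, Submodule.starProjection_eq_self_iff]

theorem isSelfAdjoint_F (k : ℤ) : IsSelfAdjoint (F k) :=
  .sub (.smul (Complex.conj_ofNat 2) (isSelfAdjoint_starProjection _)) (.one _)

theorem F_mul_self (k : ℤ) : F k * F k = 1 := by
  have hP : P k * P k = P k := isStarProjection_starProjection.isIdempotentElem
  simp only [F, sub_mul, mul_sub, smul_mul_smul_comm, hP, one_mul, mul_one]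
  module

theorem starProjection_posSpace_F (k : ℤ) : (posSpace (F k)).starProjection = P k := by
  unfold F P
  congr! 1
  exact posSpace_two_smul_starProjection_sub_one _

theorem P_e (k n : ℤ) (m : ℕ) : P k (e n m) = if n + m ≤ k then e n m else 0 := by
  split_ifs with h
  · exact Submodule.starProjection_eq_self_iff.2
      (Submodule.le_topologicalClosure _ (Submodule.subset_span ⟨n, m, h, rfl⟩))
  · refine (Submodule.starProjection_apply_eq_zero_iff _).2 ?_
    rw [Submodule.orthogonal_closure]
    refine Submodule.isOrtho_span.2 ?_ (Submodule.mem_span_singleton_self _)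
    rintro _ rfl _ ⟨n', m', h', rfl⟩
    rw [inner_e, e_apply, if_neg]
    rintro ⟨rfl, rfl⟩
    exact h h'

theorem P_apply (k : ℤ) (x : Hil) (n : ℤ) (m : ℕ) :
    P k x (n, m) = if n + m ≤ k then x (n, m) else 0 := by
  rw [← inner_e, P, ← Submodule.inner_starProjection_left_eq_right, ← P, P_e]
  split_ifs
  · exact inner_e n m x
  · exact inner_zero_left x

theorem F_apply (k : ℤ) (x : Hil) (n : ℤ) (m : ℕ) :
    F k x (n, m) = if n + m ≤ k then x (n, m) else -x (n, m) := by
  change 2 * P k x (n, m) - x (n, m) = _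
  rw [P_apply]
  split_ifs <;> ring

theorem mem_posSpace_F {k : ℤ} {x : Hil} :
    x ∈ posSpace (F k) ↔ ∀ (n : ℤ) (m : ℕ), k < n + m → x (n, m) = 0 := by
  rw [← Submodule.starProjection_eq_self_iff, starProjection_posSpace_F]
  constructor
  · intro hx n m hnm
    rw [← hx, P_apply, if_neg hnm.not_ge]
  · intro hx
    ext ⟨n, m⟩
    rw [P_apply]
    split_ifs with hnm
    · rfl
    · rw [hx n m (not_le.1 hnm)]

section Compression

variable {H : Type*} [NormedAddCommGroup H] [InnerProductSpace ℂ H] [CompleteSpace H]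
  {A : Type*} [CStarAlgebra A]

theorem compression_apply (π : A →⋆ₐ[ℂ] (H →L[ℂ] H)) (G : H →L[ℂ] H) {N : ℕ}
    (U : unitary (Matrix (Fin N) (Fin N) A)) (f : Fin N → posSpace G) (i : Fin N) :
    (compression π G U f i : H) = (posSpace G).starProjection (∑ j, π (U.1 i j) (f j)) := by
  simp [compression]

theorem compression_star_compression_apply (π : A →⋆ₐ[ℂ] (H →L[ℂ] H)) (G : H →L[ℂ] H) {N : ℕ}
    (U : unitary (Matrix (Fin N) (Fin N) A)) (f : Fin N → posSpace G) (i : Fin N) :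
    (compression π G (star U) (compression π G U f) i : H) =
      f i - (posSpace G).starProjection (∑ j, π (star (U.1 j i))
        ((posSpace G)ᗮ.starProjection (∑ l, π (U.1 j l) (f l)))) := by
  have hU (l : Fin N) : ∑ j, π (star (U.1 j i)) * π (U.1 j l) = if i = l then 1 else 0 := by
    have h := congrArg π (congrFun (congrFun (Unitary.coe_star_mul_self U) i) l)
    simpa [Matrix.mul_apply, Matrix.star_apply, Matrix.one_apply, apply_ite π] using h
  have hf : ∑ j, π (star (U.1 j i)) (∑ l, π (U.1 j l) (f l)) = f i := by
    simp only [map_sum]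
    rw [Finset.sum_comm]
    simp only [← mul_apply_eq_comp, ← sum_apply, hU]
    simp [apply_ite, ite_apply]
  simp only [compression_apply, Submodule.starProjection_orthogonal_val, map_sub,
    Finset.sum_sub_distrib, hf]
  simp [Submodule.starProjection_eq_self_iff.2 (f i).2]

end Compression

theorem exists_lp_apply_eq_inv_mul {ι 𝕜 : Type*} [NormedField 𝕜] {p : ℝ≥0∞} (w : ι → 𝕜)
    (x : lp (fun _ : ι => 𝕜) p) {c : ℝ} (hc : 0 < c) (hw : ∀ i, x i ≠ 0 → c ≤ ‖w i‖) :
    ∃ y : lp (fun _ : ι => 𝕜) p, ∀ i, y i = (w i)⁻¹ * x i := by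
  refine ⟨⟨fun i => (w i)⁻¹ * x i, ((lp.memℓp x).norm.const_mul c⁻¹).mono fun i => ?_⟩,
    fun _ => rfl⟩
  rw [norm_mul, norm_inv]
  rcases eq_or_ne (x i) 0 with hx | hx
  · simp [hx]
  · gcongr
    exact hw i hx

/-- The coordinate functional `f ↦ ⟨e_{n,m}, f_i⟩` on `N` copies of the range of `P_k`; the range
of a compression of index `-1` is described as the kernel of such a functional. -/
noncomputable def coordFunctional (k : ℤ) {N : ℕ} (i : Fin N) (n : ℤ) (m : ℕ) :
    (Fin N → posSpace (F k)) →L[ℂ] ℂ :=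
  innerSL ℂ (e n m) ∘L (posSpace (F k)).subtypeL ∘L ContinuousLinearMap.proj i

theorem coordFunctional_apply (k : ℤ) {N : ℕ} (i : Fin N) (n : ℤ) (m : ℕ)
    (f : Fin N → posSpace (F k)) : coordFunctional k i n m f = (f i : Hil) (n, m) :=
  inner_e n m (f i)

theorem coordFunctional_surjective (k : ℤ) {N : ℕ} (i : Fin N) {n : ℤ} {m : ℕ} (h : n + m ≤ k) :
    Function.Surjective (coordFunctional k i n m) := by
  have he : e n m ∈ posSpace (F k) := by
    rw [← Submodule.starProjection_eq_self_iff, starProjection_posSpace_F, P_e, if_pos h]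
  refine fun z => ⟨fun _ => z • ⟨e n m, he⟩, ?_⟩
  rw [coordFunctional_apply, Submodule.coe_smul, hil_smul_apply, e_apply, if_pos ⟨rfl, rfl⟩,
    mul_one]

theorem posSpace_ext {k : ℤ} {N : ℕ} {f g : Fin N → posSpace (F k)}
    (h : ∀ (i : Fin N) (n : ℤ) (m : ℕ), n + m ≤ k → (f i : Hil) (n, m) = (g i : Hil) (n, m)) :
    f = g := by
  ext i ⟨n, m⟩
  by_cases hnm : n + m ≤ k
  · exact h i n m hnm
  · rw [mem_posSpace_F.1 (f i).2 n m (not_le.1 hnm), mem_posSpace_F.1 (g i).2 n m (not_le.1 hnm)]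

section Parametrix

variable {k : ℤ} {N : ℕ} {T S : (Fin N → posSpace (F k)) →L[ℂ] (Fin N → posSpace (F k))}
  {w : Fin N → ℤ × ℕ → ℂ}

theorem injective_of_comp_diagonal
    (hST : ∀ f i n (m : ℕ), n + m ≤ k → (S (T f) i : Hil) (n, m) = w i (n, m) * (f i : Hil) (n, m))
    (hw : ∀ i n (m : ℕ), n + m ≤ k → w i (n, m) ≠ 0) : Function.Injective T := by
  refine (injective_iff_map_eq_zero T).2 fun f hf => posSpace_ext fun i n m h => ?_
  have h0 := hST f i n m h
  rw [hf, map_zero] at h0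
  exact (mul_eq_zero.1 h0.symm).resolve_left (hw i n m h)

theorem ker_coordFunctional_le_range {i₀ : Fin N} {n₀ : ℤ} {m₀ : ℕ} {c : ℝ} (hc : 0 < c)
    (hTS : ∀ g i n (m : ℕ), n + m ≤ k → (T (S g) i : Hil) (n, m) = w i (n, m) * (g i : Hil) (n, m))
    (hw : ∀ i n (m : ℕ), n + m ≤ k → (i, n, m) ≠ (i₀, n₀, m₀) → c ≤ ‖w i (n, m)‖) :
    (coordFunctional k i₀ n₀ m₀).ker ≤ T.range := by
  intro g hg
  have hg₀ : (g i₀ : Hil) (n₀, m₀) = 0 := (coordFunctional_apply k i₀ n₀ m₀ g).symm.trans hg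
  have hwg (i n m) (hne : (g i : Hil) (n, m) ≠ 0) : c ≤ ‖w i (n, m)‖ := by
    refine hw i n m (not_lt.1 fun h => hne (mem_posSpace_F.1 (g i).2 n m h)) ?_
    rintro ⟨⟩
    exact hne hg₀
  choose y hy using fun i =>
    exists_lp_apply_eq_inv_mul (w i) (g i : Hil) hc fun nm => hwg i nm.1 nm.2
  have hyk (i) : y i ∈ posSpace (F k) := mem_posSpace_F.2 fun n m h => by
    rw [hy, mem_posSpace_F.1 (g i).2 n m h, mul_zero]
  refine ⟨S fun i => ⟨y i, hyk i⟩, posSpace_ext fun i n m h => (hTS _ i n m h).trans ?_⟩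
  rcases eq_or_ne ((g i : Hil) (n, m)) 0 with hgi | hgi
  · rw [hy, hgi, mul_zero, mul_zero]
  · rw [hy, mul_inv_cancel_left₀ (norm_pos_iff.1 (hc.trans_le (hwg i n m hgi)))]

end Parametrix

theorem isFredholm_and_fredholmIndex_of_ker_coordFunctional {k : ℤ} {N : ℕ}
    {T : (Fin N → posSpace (F k)) →L[ℂ] (Fin N → posSpace (F k))} {i : Fin N} {n : ℤ} {m : ℕ}
    (hnm : n + m ≤ k) (hT : Function.Injective T) (hle : (coordFunctional k i n m).ker ≤ T.range)
    (hzero : ∀ f, (T f i : Hil) (n, m) = 0) : T.IsFredholm ∧ fredholmIndex T = -1 := by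
  have hφ := coordFunctional_surjective k i hnm
  have hrange : T.range = (coordFunctional k i n m).ker := by
    refine le_antisymm ?_ hle
    rintro _ ⟨f, rfl⟩
    exact (coordFunctional_apply k i n m _).trans (hzero f)
  refine ⟨isFredholm_of_range_eq_ker hT hφ hrange, ?_⟩
  rw [fredholmIndex_of_range_eq_ker hT hφ hrange, Module.finrank_self, Nat.cast_one]

section Relations

variable {q : ℝ} {B : Type*} [CStarAlgebra B] {u : Matrix (Fin 2) (Fin 2) B}

theorem IsSUq2Matrix.star_eq (h : IsSUq2Matrix q u) (hq : q ≠ 0) :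
    star u = !![u 1 1, -((q : ℂ)⁻¹ • u 0 1); -((q : ℂ) • u 1 0), u 0 0] := by
  have hq' : (q : ℂ) ≠ 0 := Complex.ofReal_ne_zero.2 hq
  have hleft : star u * u = 1 := by
    ext1 i j
    exact (h.col i j).trans Matrix.one_apply.symm
  refine left_inv_eq_right_inv hleft ?_
  have hdet (i j : Fin 2) : u i 0 * u j 1 - (q : ℂ) • (u i 1 * u j 0) = detCoeff q i j • 1 := by
    rw [← h.det i j]
    simp [detCoeff, Fin.sum_univ_two, sub_eq_add_neg, -Complex.coe_smul]
  have hinv (i j : Fin 2) : -((q : ℂ)⁻¹ • (u i 0 * u j 1)) + u i 1 * u j 0 =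
      -((q : ℂ)⁻¹ • detCoeff q i j • 1) := by
    rw [← hdet, smul_sub, inv_smul_smul₀ hq', neg_sub, sub_eq_neg_add]
  ext1 i j
  rw [Matrix.mul_apply, Fin.sum_univ_two]
  match i, j with
  | 0, 0 => simpa [detCoeff, sub_eq_add_neg, -Complex.coe_smul] using hdet 0 1
  | 0, 1 => simpa [detCoeff, -Complex.coe_smul] using hinv 0 0
  | 1, 0 => simpa [detCoeff, sub_eq_add_neg, -Complex.coe_smul] using hdet 1 1
  | 1, 1 => simpa [detCoeff, hq', -Complex.coe_smul] using hinv 1 0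

theorem IsSUq2Matrix.star_00 (h : IsSUq2Matrix q u) (hq : q ≠ 0) : star (u 0 0) = u 1 1 :=
  congrFun₂ (h.star_eq hq) 0 0

theorem IsSUq2Matrix.star_01 (h : IsSUq2Matrix q u) (hq : q ≠ 0) :
    star (u 0 1) = -((q : ℂ) • u 1 0) :=
  congrFun₂ (h.star_eq hq) 1 0

theorem IsSUq2Matrix.star_10 (h : IsSUq2Matrix q u) (hq : q ≠ 0) :
    star (u 1 0) = -((q : ℂ)⁻¹ • u 0 1) :=
  congrFun₂ (h.star_eq hq) 0 1

theorem IsSUq2Matrix.star_11 (h : IsSUq2Matrix q u) (hq : q ≠ 0) : star (u 1 1) = u 0 0 :=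
  congrFun₂ (h.star_eq hq) 1 1

end Relations

theorem one_sub_sq_le_norm_one_sub_pow {q : ℝ} (hq : q ∈ Set.Ioo (0 : ℝ) 1) {l : ℕ}
    (hl : l ≠ 0) :
    1 - q ^ 2 ≤ ‖1 - (q : ℂ) ^ (2 * l)‖ := by
  have hpow : q ^ (2 * l) ≤ q ^ 2 := pow_le_pow_of_le_one hq.1.le hq.2.le (by lia)
  calc 1 - q ^ 2 ≤ 1 - q ^ (2 * l) := by gcongr
    _ ≤ |1 - q ^ (2 * l)| := le_abs_self _
    _ = ‖1 - (q : ℂ) ^ (2 * l)‖ := by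
      rw [← Complex.ofReal_pow, ← Complex.ofReal_one, ← Complex.ofReal_sub, Complex.norm_real,
        Real.norm_eq_abs]

section Chi

variable {q : ℝ} (hq : q ∈ Set.Ioo (0 : ℝ) 1)

theorem chiMatrix_00_apply (x : Hil) (n : ℤ) (m : ℕ) :
    chiMatrix hq 0 0 x (n, m) = (√(1 - q ^ (2 * m + 2)) : ℝ) * x (n - 1, m + 1) := by
  change star tOp (rootN hq (SOp x)) (n, m) = _
  rw [star_tOp_apply, rootN, diagOp_apply, SOp_apply]

theorem chiMatrix_01_apply (x : Hil) (n : ℤ) (m : ℕ) :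
    chiMatrix hq 0 1 x (n, m) = -(q : ℂ) ^ (m + 1) * x (n - 1, m) := by
  change -(star tOp (qN1 hq x) (n, m)) = _
  rw [star_tOp_apply, qN1, diagOp_apply, Complex.ofReal_pow, neg_mul]

theorem chiMatrix_10_apply (x : Hil) (n : ℤ) (m : ℕ) :
    chiMatrix hq 1 0 x (n, m) = (q : ℂ) ^ m * x (n + 1, m) := by
  change tOp (qN hq x) (n, m) = _
  rw [tOp_apply, qN, diagOp_apply, Complex.ofReal_pow]

-- At `m = 0` the coefficient vanishes, so the truncated `m - 1` is harmless.
theorem chiMatrix_11_apply (x : Hil) (n : ℤ) (m : ℕ) :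
    chiMatrix hq 1 1 x (n, m) = (√(1 - q ^ (2 * m)) : ℝ) * x (n + 1, m - 1) := by
  change tOp (star SOp (rootN hq x)) (n, m) = _
  rcases m with _ | m
  · simp [tOp_apply, star_SOp_apply_zero]
  · rw [tOp_apply, star_SOp_apply_succ, rootN, diagOp_apply, mul_add_one, Nat.add_sub_cancel]

theorem star_chiMatrix_01_apply (x : Hil) (n : ℤ) (m : ℕ) :
    star (chiMatrix hq 0 1) x (n, m) = -(q : ℂ) ^ (m + 1) * x (n + 1, m) := by
  rw [(isSUq2Matrix_chiMatrix hq).star_01 hq.1.ne']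
  change -((q : ℂ) * chiMatrix hq 1 0 x (n, m)) = _
  rw [chiMatrix_10_apply]
  ring

theorem star_chiMatrix_10_apply (x : Hil) (n : ℤ) (m : ℕ) :
    star (chiMatrix hq 1 0) x (n, m) = (q : ℂ) ^ m * x (n - 1, m) := by
  rw [(isSUq2Matrix_chiMatrix hq).star_10 hq.1.ne']
  change -((q : ℂ)⁻¹ * chiMatrix hq 0 1 x (n, m)) = _
  have hq' : (q : ℂ) ≠ 0 := Complex.ofReal_ne_zero.2 hq.1.ne'
  rw [chiMatrix_01_apply]
  field_simp
  ring

theorem starProjection_posSpace_F_orthogonal_apply (k : ℤ) (x : Hil) (n : ℤ) (m : ℕ) :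
    (posSpace (F k))ᗮ.starProjection x (n, m) = if n + m ≤ k then 0 else x (n, m) := by
  rw [Submodule.starProjection_orthogonal_val, starProjection_posSpace_F]
  change x (n, m) - P k x (n, m) = _
  rw [P_apply]
  split_ifs <;> simp

theorem chiMatrix_00_mem_posSpace {k : ℤ} {x : Hil} (hx : x ∈ posSpace (F k)) :
    chiMatrix hq 0 0 x ∈ posSpace (F k) :=
  mem_posSpace_F.2 fun n m h => by
    rw [chiMatrix_00_apply, mem_posSpace_F.1 hx _ _ (by lia), mul_zero]

theorem chiMatrix_10_mem_posSpace {k : ℤ} {x : Hil} (hx : x ∈ posSpace (F k)) :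
    chiMatrix hq 1 0 x ∈ posSpace (F k) :=
  mem_posSpace_F.2 fun n m h => by
    rw [chiMatrix_10_apply, mem_posSpace_F.1 hx _ _ (by lia), mul_zero]

theorem chiMatrix_11_mem_posSpace {k : ℤ} {x : Hil} (hx : x ∈ posSpace (F k)) :
    chiMatrix hq 1 1 x ∈ posSpace (F k) :=
  mem_posSpace_F.2 fun n m h => by
    rw [chiMatrix_11_apply, mem_posSpace_F.1 hx _ _ (by lia), mul_zero]

theorem star_chiMatrix_01_mem_posSpace {k : ℤ} {x : Hil} (hx : x ∈ posSpace (F k)) :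
    star (chiMatrix hq 0 1) x ∈ posSpace (F k) :=
  mem_posSpace_F.2 fun n m h => by
    rw [star_chiMatrix_01_apply, mem_posSpace_F.1 hx _ _ (by lia), mul_zero]

theorem compression_star_fundamentalUnitary_comp (k : ℤ) (f : Fin 2 → posSpace (F k))
    (i : Fin 2) :
    (compression (chi hq) (F k) (star (fundamentalUnitary q))
      (compression (chi hq) (F k) (fundamentalUnitary q) f) i : Hil) =
    f i - P k (star (chiMatrix hq 0 i)
      ((posSpace (F k))ᗮ.starProjection (chiMatrix hq 0 1 (f 1)))) := by
  have hentry (j l : Fin 2) : chi hq ((fundamentalUnitary q).1 j l) = chiMatrix hq j l := rfl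
  have hstar (j : Fin 2) : chi hq (star ((fundamentalUnitary q).1 j i)) = star (chiMatrix hq j i) :=
    map_star _ _
  have hzero {x : Hil} (hx : x ∈ posSpace (F k)) : (posSpace (F k))ᗮ.starProjection x = 0 :=
    Submodule.starProjection_orthogonal_apply_eq_zero hx
  simp only [compression_star_compression_apply, Fin.sum_univ_two, hentry, hstar, map_add,
    hzero (chiMatrix_00_mem_posSpace hq (f 0).2), hzero (chiMatrix_10_mem_posSpace hq (f 0).2),
    hzero (chiMatrix_11_mem_posSpace hq (f 1).2), zero_add, map_zero, add_zero,
    starProjection_posSpace_F]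

theorem compression_fundamentalUnitary_comp_star (k : ℤ) (g : Fin 2 → posSpace (F k))
    (i : Fin 2) :
    (compression (chi hq) (F k) (fundamentalUnitary q)
      (compression (chi hq) (F k) (star (fundamentalUnitary q)) g) i : Hil) =
    g i - P k (chiMatrix hq i 0
      ((posSpace (F k))ᗮ.starProjection (star (chiMatrix hq 1 0) (g 1)))) := by
  have hu := isSUq2Matrix_chiMatrix hq
  have hentry (j l : Fin 2) : chi hq ((star (fundamentalUnitary q)).1 j l) =
      star (chiMatrix hq l j) := map_star (chi hq) (gen q l j)
  have hstar (j : Fin 2) : chi hq (star ((star (fundamentalUnitary q)).1 j i)) =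
      chiMatrix hq i j := by
    rw [map_star, hentry, star_star]
  have hzero {x : Hil} (hx : x ∈ posSpace (F k)) : (posSpace (F k))ᗮ.starProjection x = 0 :=
    Submodule.starProjection_orthogonal_apply_eq_zero hx
  have hcomp := compression_star_compression_apply (chi hq) (F k) (star (fundamentalUnitary q)) g i
  rw [star_star] at hcomp
  simp only [hcomp, hstar, hentry, Fin.sum_univ_two, map_add, hu.star_00 hq.1.ne',
    hu.star_11 hq.1.ne', hzero (chiMatrix_11_mem_posSpace hq (g 0).2),
    hzero (star_chiMatrix_01_mem_posSpace hq (g 0).2),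
    hzero (chiMatrix_00_mem_posSpace hq (g 1).2), zero_add, map_zero, add_zero,
    starProjection_posSpace_F]

theorem compression_star_fundamentalUnitary_comp_apply (k : ℤ) (f : Fin 2 → posSpace (F k))
    (i : Fin 2) {n : ℤ} {m : ℕ} (h : n + m ≤ k) :
    (compression (chi hq) (F k) (star (fundamentalUnitary q))
      (compression (chi hq) (F k) (fundamentalUnitary q) f) i : Hil) (n, m) =
    (1 - if i = 1 ∧ n + m = k then (q : ℂ) ^ (2 * (m + 1)) else 0) * (f i : Hil) (n, m) := by
  rw [compression_star_fundamentalUnitary_comp]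
  change (f i : Hil) (n, m) - P k (star (chiMatrix hq 0 i) _) (n, m) = _
  rw [P_apply, if_pos h]
  match i with
  | 0 =>
    rw [(isSUq2Matrix_chiMatrix hq).star_00 hq.1.ne', chiMatrix_11_apply,
      starProjection_posSpace_F_orthogonal_apply]
    rcases m with _ | m
    · simp
    · rw [if_pos (by push_cast at h; lia)]
      simp
  | 1 =>
    rw [star_chiMatrix_01_apply, starProjection_posSpace_F_orthogonal_apply, chiMatrix_01_apply,
      add_sub_cancel_right]
    simp only [true_and]
    split_ifs <;> first | lia | ring

theorem compression_fundamentalUnitary_comp_star_apply (k : ℤ) (g : Fin 2 → posSpace (F k))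
    (i : Fin 2) {n : ℤ} {m : ℕ} (h : n + m ≤ k) :
    (compression (chi hq) (F k) (fundamentalUnitary q)
      (compression (chi hq) (F k) (star (fundamentalUnitary q)) g) i : Hil) (n, m) =
    (1 - if i = 1 ∧ n + m = k then (q : ℂ) ^ (2 * m) else 0) * (g i : Hil) (n, m) := by
  rw [compression_fundamentalUnitary_comp_star]
  change (g i : Hil) (n, m) - P k (chiMatrix hq i 0 _) (n, m) = _
  rw [P_apply, if_pos h]
  match i with
  | 0 =>
    rw [chiMatrix_00_apply, starProjection_posSpace_F_orthogonal_apply, if_pos (by lia)]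
    simp
  | 1 =>
    rw [chiMatrix_10_apply, starProjection_posSpace_F_orthogonal_apply, star_chiMatrix_10_apply,
      add_sub_cancel_right]
    simp only [true_and]
    split_ifs <;> first | lia | ring

theorem compression_fundamentalUnitary_apply_one (k : ℤ) (f : Fin 2 → posSpace (F k)) :
    (compression (chi hq) (F k) (fundamentalUnitary q) f 1 : Hil) (k, 0) = 0 := by
  rw [compression_apply, starProjection_posSpace_F, P_apply, if_pos (by simp), Fin.sum_univ_two]
  change chiMatrix hq 1 0 (f 0) (k, 0) + chiMatrix hq 1 1 (f 1) (k, 0) = 0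
  rw [chiMatrix_10_apply, chiMatrix_11_apply, mem_posSpace_F.1 (f 0).2 _ _ (by simp)]
  simp

theorem isFredholm_and_indexPairing_fundamentalUnitary (k : ℤ) :
    (compression (chi hq) (F k) (fundamentalUnitary q)).IsFredholm ∧
      indexPairing (chi hq) (F k) (fundamentalUnitary q) = -1 := by
  have hpos : 0 < 1 - q ^ 2 := by nlinarith [hq.1, hq.2]
  refine isFredholm_and_fredholmIndex_of_ker_coordFunctional (i := 1) (n := k) (m := 0) (by simp)
    (injective_of_comp_diagonal (S := compression (chi hq) (F k) (star (fundamentalUnitary q)))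
      (w := fun i nm => 1 - if i = 1 ∧ nm.1 + nm.2 = k then (q : ℂ) ^ (2 * (nm.2 + 1)) else 0)
      (fun f i n m h => compression_star_fundamentalUnitary_comp_apply hq k f i h) ?_)
    (ker_coordFunctional_le_range (S := compression (chi hq) (F k) (star (fundamentalUnitary q)))
      (w := fun i nm => 1 - if i = 1 ∧ nm.1 + nm.2 = k then (q : ℂ) ^ (2 * nm.2) else 0) hpos
      (fun g i n m h => compression_fundamentalUnitary_comp_star_apply hq k g i h) ?_)
    (compression_fundamentalUnitary_apply_one hq k)
  · intro i n m _
    dsimp only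
    split_ifs
    · exact norm_pos_iff.1 (hpos.trans_le (one_sub_sq_le_norm_one_sub_pow hq m.succ_ne_zero))
    · simp
  · intro i n m _ hne
    dsimp only
    split_ifs with hi
    · refine one_sub_sq_le_norm_one_sub_pow hq ?_
      rintro rfl
      simp_all
    · simpa using sq_nonneg q

end Chi

section BasicUnitary

theorem pOp_apply (x : Hil) (n : ℤ) (m : ℕ) : pOp x (n, m) = if m = 0 then x (n, 0) else 0 := by
  change x (n, m) - star SOp (SOp x) (n, m) = _
  rcases m with _ | m
  · rw [star_SOp_apply_zero, sub_zero, if_pos rfl]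
  · rw [star_SOp_apply_succ, SOp_apply, sub_self, if_neg m.succ_ne_zero]

theorem star_pOp : star pOp = pOp := by
  rw [pOp, star_sub, star_one, star_mul, star_star]

theorem tOp_mul_pOp_add_one_sub_pOp_apply (x : Hil) (n : ℤ) (m : ℕ) :
    (tOp * pOp + 1 - pOp) x (n, m) = if m = 0 then x (n + 1, 0) else x (n, m) := by
  change tOp (pOp x) (n, m) + x (n, m) - pOp x (n, m) = _
  rw [tOp_apply, pOp_apply, pOp_apply]
  split_ifs with hm
  · rw [hm, add_sub_cancel_right]
  · rw [zero_add, sub_zero]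

theorem star_tOp_mul_pOp_add_one_sub_pOp_apply (x : Hil) (n : ℤ) (m : ℕ) :
    star (tOp * pOp + 1 - pOp) x (n, m) = if m = 0 then x (n - 1, 0) else x (n, m) := by
  rw [star_sub, star_add, star_mul, star_one, star_pOp]
  change pOp (star tOp x) (n, m) + x (n, m) - pOp x (n, m) = _
  rw [pOp_apply, pOp_apply, star_tOp_apply]
  split_ifs with hm
  · rw [hm, add_sub_cancel_right]
  · rw [zero_add, sub_zero]

variable {A : Type*} [CStarAlgebra A] {π : A →⋆ₐ[ℂ] (Hil →L[ℂ] Hil)}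
  {v : unitary (Matrix (Fin 1) (Fin 1) A)}

theorem compression_star_comp_of_eq (hv : π (v.1 0 0) = tOp * pOp + 1 - pOp) (k : ℤ)
    (f : Fin 1 → posSpace (F k)) :
    compression π (F k) (star v) (compression π (F k) v f) = f := by
  have hf : (tOp * pOp + 1 - pOp) (f 0 : Hil) ∈ posSpace (F k) := mem_posSpace_F.2 fun n m h => by
    rw [tOp_mul_pOp_add_one_sub_pOp_apply, mem_posSpace_F.1 (f 0).2 n m h]
    split_ifs with hm
    · exact mem_posSpace_F.1 (f 0).2 _ _ (by lia)
    · rfl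
  ext i : 2
  rw [Subsingleton.elim i 0, compression_star_compression_apply, Fin.sum_univ_one,
    Fin.sum_univ_one, hv, Submodule.starProjection_orthogonal_apply_eq_zero hf, map_zero, map_zero,
    sub_zero]

theorem compression_comp_star_apply_of_eq (hv : π (v.1 0 0) = tOp * pOp + 1 - pOp) (k : ℤ)
    (g : Fin 1 → posSpace (F k)) (i : Fin 1) {n : ℤ} {m : ℕ} (h : n + m ≤ k) :
    (compression π (F k) v (compression π (F k) (star v) g) i : Hil) (n, m) =
      (1 - if (n, m) = (k, 0) then 1 else 0) * (g i : Hil) (n, m) := by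
  have hentry : π ((star v).1 0 0) = star (tOp * pOp + 1 - pOp) := by
    rw [← hv, ← map_star]
    rfl
  have hcomp := compression_star_compression_apply π (F k) (star v) g 0
  rw [star_star, Fin.sum_univ_one, Fin.sum_univ_one, map_star, hentry, star_star,
    starProjection_posSpace_F] at hcomp
  rw [Subsingleton.elim i 0, hcomp]
  change (g 0 : Hil) (n, m) - P k _ (n, m) = _
  rw [P_apply, if_pos h, tOp_mul_pOp_add_one_sub_pOp_apply]
  rcases m with _ | m
  · rw [if_pos rfl, starProjection_posSpace_F_orthogonal_apply,
      star_tOp_mul_pOp_add_one_sub_pOp_apply, if_pos rfl, add_sub_cancel_right]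
    rcases eq_or_ne n k with rfl | hnk
    · simp
    · rw [if_pos (by lia), if_neg (by simp [hnk]), sub_zero, sub_zero, one_mul]
  · rw [if_neg m.succ_ne_zero, starProjection_posSpace_F_orthogonal_apply, if_pos h,
      if_neg (by simp), sub_zero, sub_zero, one_mul]

theorem compression_apply_zero_of_eq (hv : π (v.1 0 0) = tOp * pOp + 1 - pOp) (k : ℤ)
    (f : Fin 1 → posSpace (F k)) :
    (compression π (F k) v f 0 : Hil) (k, 0) = 0 := by
  rw [compression_apply, starProjection_posSpace_F, P_apply, if_pos (by simp), Fin.sum_univ_one,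
    hv, tOp_mul_pOp_add_one_sub_pOp_apply, if_pos rfl]
  exact mem_posSpace_F.1 (f 0).2 _ _ (by simp)

theorem isFredholm_and_indexPairing_of_eq (hv : π (v.1 0 0) = tOp * pOp + 1 - pOp) (k : ℤ) :
    (compression π (F k) v).IsFredholm ∧ indexPairing π (F k) v = -1 := by
  refine isFredholm_and_fredholmIndex_of_ker_coordFunctional (n := k) (m := 0) (by simp)
    (Function.LeftInverse.injective (g := compression π (F k) (star v))
      (compression_star_comp_of_eq hv k))
    (ker_coordFunctional_le_range (S := compression π (F k) (star v))
      (w := fun _ nm => 1 - if nm = (k, 0) then 1 else 0) one_pos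
      (fun g i n m h => compression_comp_star_apply_of_eq hv k g i h) ?_)
    (compression_apply_zero_of_eq hv k)
  intro i n m _ hne
  have hnm : (n, m) ≠ (k, 0) := fun h => hne (by rw [Subsingleton.elim i 0, h])
  rw [if_neg hnm, sub_zero, norm_one]

end BasicUnitary

section Compact

theorem isCompactOperator_of_summable_norm_evalCLM_comp {𝕜 ι E : Type*}
    [NontriviallyNormedField 𝕜] [NormedAddCommGroup E] [NormedSpace 𝕜 E] {G : ι → Type*}
    [∀ i, NormedAddCommGroup (G i)] [∀ i, NormedSpace 𝕜 (G i)] [∀ i, ProperSpace (G i)]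
    {p : ℝ≥0∞} [Fact (1 ≤ p)] (hp : p ≠ ∞) (T : E →L[𝕜] lp G p)
    (hT : Summable fun i => ‖lp.evalCLM 𝕜 G p i ∘L T‖) : IsCompactOperator T := by
  classical
  let R (i : ι) : E →L[𝕜] lp G p := lp.singleContinuousLinearMap 𝕜 G p i ∘L lp.evalCLM 𝕜 G p i ∘L T
  have hR (i : ι) : IsCompactOperator (R i) :=
    (isCompactOperator_of_locallyCompactSpace_rng (lp.singleContinuousLinearMap 𝕜 G p i)).comp_clm _
  have hsum : Summable R := .of_norm_bounded hT fun i =>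
    ContinuousLinearMap.opNorm_le_bound _ (norm_nonneg _) fun x =>
      (lp.norm_single (zero_lt_one.trans_le Fact.out) i _).trans_le
        ((lp.evalCLM 𝕜 G p i ∘L T).le_opNorm x)
  have hTR : HasSum R T := by
    convert hsum.hasSum
    ext1 x
    exact (lp.hasSum_single hp (T x)).unique
      (hsum.hasSum.mapL (ContinuousLinearMap.apply 𝕜 (lp G p) x))
  exact isClosed_setOfPred_isCompactOperator.mem_of_tendsto hTR
    (.of_forall fun s => (compactOperator (RingHom.id 𝕜) E (lp G p)).sum_mem fun i _ => hR i)

theorem isCompactOperator_F_commutator (k : ℤ) {T : Hil →L[ℂ] Hil} {w : ℤ × ℕ → ℂ}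
    {g : ℤ × ℕ → ℤ × ℕ} (hT : ∀ x i, T x i = w i * x (g i))
    (hw : Summable fun i => if (i.1 + i.2 ≤ k ↔ (g i).1 + (g i).2 ≤ k) then 0 else ‖w i‖) :
    IsCompactOperator (F k * T - T * F k) := by
  refine isCompactOperator_of_summable_norm_evalCLM_comp (by simp) _ ?_
  refine .of_nonneg_of_le (fun _ => norm_nonneg _) (fun i => ?_) (hw.mul_left 2)
  refine ContinuousLinearMap.opNorm_le_bound _ (by positivity) fun x => ?_
  change ‖F k (T x) i - T (F k x) i‖ ≤ _
  rw [hT, ← Prod.mk.eta (p := i), F_apply, hT, ← Prod.mk.eta (p := g i), F_apply]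
  by_cases h : i.1 + i.2 ≤ k ↔ (g i).1 + (g i).2 ≤ k
  · simp [h]
  · rw [if_neg h]
    refine (norm_sub_le _ _).trans ?_
    calc _ = 2 * ‖w i‖ * ‖x (g i)‖ := by
          split_ifs <;> simp only [norm_neg, norm_mul] <;> ring
      _ ≤ 2 * ‖w i‖ * ‖x‖ := by
          gcongr
          exact lp.norm_apply_le_norm two_ne_zero x (g i)

theorem summable_antidiagonal_of_norm_lt_one {r : ℂ} (hr : ‖r‖ < 1) (l : ℤ) :
    Summable fun i : ℤ × ℕ => if i.1 + i.2 = l then ‖r ^ i.2‖ else 0 := by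
  have hinj : Function.Injective fun m : ℕ => (l - m, m) := fun _ _ h => congrArg Prod.snd h
  rw [← hinj.summable_iff]
  · simpa [Function.comp_def] using summable_geometric_of_lt_one (norm_nonneg r) hr
  · rintro ⟨n, m⟩ h
    refine if_neg fun hnm => h ⟨m, ?_⟩
    exact Prod.ext (sub_eq_iff_eq_add.2 hnm.symm) rfl

theorem isCompactOperator_F_commutator_of_shift (k : ℤ) {T : Hil →L[ℂ] Hil} {c r : ℂ} {d : ℤ}
    (hr : ‖r‖ < 1) (hd : |d| ≤ 1) (hT : ∀ x n m, T x (n, m) = c * r ^ m * x (n + d, m)) :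
    IsCompactOperator (F k * T - T * F k) := by
  refine isCompactOperator_F_commutator k (w := fun i => c * r ^ i.2) (g := fun i => (i.1 + d, i.2))
    (fun x i => hT x i.1 i.2) ?_
  have hsum := ((summable_antidiagonal_of_norm_lt_one hr k).add
    (summable_antidiagonal_of_norm_lt_one hr (k + 1))).mul_left ‖c‖
  refine hsum.of_nonneg_of_le (fun i => by positivity) fun i => ?_
  rw [abs_le] at hd
  rw [norm_mul]
  split_ifs <;> first | lia | (simp; done) | positivity

theorem isCompactOperator_F_commutator_of_antidiagonal (k : ℤ) {T : Hil →L[ℂ] Hil}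
    {w : ℤ × ℕ → ℂ} {g : ℤ × ℕ → ℤ × ℕ} (hT : ∀ x i, T x i = w i * x (g i))
    (hg : ∀ i, w i ≠ 0 → (g i).1 + (g i).2 = i.1 + i.2) :
    IsCompactOperator (F k * T - T * F k) := by
  refine isCompactOperator_F_commutator k hT (summable_zero.congr fun i => ?_)
  by_cases hi : w i = 0
  · simp [hi]
  · rw [hg i hi, if_pos Iff.rfl]

end Compact

section EssentialCommutant

variable {H : Type*} [NormedAddCommGroup H] [NormedSpace ℂ H]

/-- The operators commuting with `G` modulo the compact operators. -/
noncomputable def essentialCommutant (G : H →L[ℂ] H) : Subalgebra ℂ (H →L[ℂ] H) where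
  carrier := {T | IsCompactOperator (G * T - T * G)}
  algebraMap_mem' r := by
    rw [Set.mem_ofPred_eq, Algebra.commutes, sub_self]
    exact isCompactOperator_zero
  add_mem' {S T} hS hT := by
    have h : G * (S + T) - (S + T) * G = (G * S - S * G) + (G * T - T * G) := by noncomm_ring
    rw [Set.mem_ofPred_eq, h]
    exact hS.add hT
  mul_mem' {S T} hS hT := by
    have h : G * (S * T) - S * T * G = (G * S - S * G) * T + S * (G * T - T * G) := by noncomm_ring
    rw [Set.mem_ofPred_eq, h]
    exact (hS.comp_clm T).add (hT.clm_comp S)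

theorem isClosed_essentialCommutant [CompleteSpace H] (G : H →L[ℂ] H) :
    IsClosed (essentialCommutant G : Set (H →L[ℂ] H)) :=
  isClosed_setOfPred_isCompactOperator.preimage
    (f := fun T : H →L[ℂ] H => G * T - T * G) (by fun_prop)

end EssentialCommutant

theorem lift_mem_of_isClosed {q : ℝ} {B : Type} [CStarAlgebra B] [Nontrivial B]
    {u : Matrix (Fin 2) (Fin 2) B} (hu : IsSUq2Matrix q u) {S : Subalgebra ℂ B}
    (hS : IsClosed (S : Set B)) (hmem : ∀ i j, u i j ∈ S) (hstar : ∀ i j, star (u i j) ∈ S)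
    (a : CSUq2 q) : lift u hu a ∈ S := by
  let ρ : Realization q := ⟨B, u, hu⟩
  let ev : Ambient q →ₐ[ℂ] B :=
    { toFun a := a ρ
      map_one' := rfl
      map_mul' _ _ := rfl
      map_zero' := rfl
      map_add' _ _ := rfl
      commutes' _ := rfl }
  have hev : Continuous ev := (lp.evalCLM ℂ (fun ρ : Realization q => ρ.B) ∞ ρ).continuous
  have hsub : (StarAlgebra.adjoin ℂ (Set.range fun ij : Fin 2 × Fin 2 =>
      ambientGen q ij.1 ij.2) : Set (Ambient q)) ⊆ ev ⁻¹' S := by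
    refine Algebra.adjoin_le (S := S.comap ev) (Set.union_subset ?_ fun x hx => ?_)
    · rintro _ ⟨ij, rfl⟩
      exact hmem ij.1 ij.2
    · obtain ⟨ij, hij⟩ := hx
      rw [← star_star x, ← hij]
      exact hstar ij.1 ij.2
  exact closure_minimal hsub (hS.preimage hev) a.2

section FredholmModule

variable {q : ℝ} (hq : q ∈ Set.Ioo (0 : ℝ) 1) (k : ℤ)

theorem chiMatrix_mem_essentialCommutant (i j : Fin 2) :
    chiMatrix hq i j ∈ essentialCommutant (F k) := by
  have hr : ‖(q : ℂ)‖ < 1 := by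
    rw [Complex.norm_real, Real.norm_of_nonneg hq.1.le]
    exact hq.2
  match i, j with
  | 0, 0 =>
    exact isCompactOperator_F_commutator_of_antidiagonal k (g := fun i => (i.1 - 1, i.2 + 1))
      (fun x i => chiMatrix_00_apply hq x i.1 i.2) fun i _ => by push_cast; ring
  | 0, 1 =>
    exact isCompactOperator_F_commutator_of_shift k (c := -q) (d := -1) hr (by simp)
      fun x n m => by rw [chiMatrix_01_apply, pow_succ, ← sub_eq_add_neg]; ring
  | 1, 0 =>
    exact isCompactOperator_F_commutator_of_shift k (c := 1) (d := 1) hr (by simp)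
      fun x n m => by rw [chiMatrix_10_apply, one_mul]
  | 1, 1 =>
    exact isCompactOperator_F_commutator_of_antidiagonal k (g := fun i => (i.1 + 1, i.2 - 1))
      (fun x i => chiMatrix_11_apply hq x i.1 i.2) fun i hi => by
        have : i.2 ≠ 0 := by
          intro h0
          simp [h0] at hi
        lia

theorem star_chiMatrix_mem_essentialCommutant (i j : Fin 2) :
    star (chiMatrix hq i j) ∈ essentialCommutant (F k) := by
  have hu := isSUq2Matrix_chiMatrix hq
  have hmem := chiMatrix_mem_essentialCommutant hq k
  match i, j with
  | 0, 0 => exact hu.star_00 hq.1.ne' ▸ hmem 1 1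
  | 0, 1 => exact hu.star_01 hq.1.ne' ▸ neg_mem (Subalgebra.smul_mem _ (hmem 1 0) _)
  | 1, 0 => exact hu.star_10 hq.1.ne' ▸ neg_mem (Subalgebra.smul_mem _ (hmem 0 1) _)
  | 1, 1 => exact hu.star_11 hq.1.ne' ▸ hmem 0 0

theorem isOddFredholmModule_chi : IsOddFredholmModule (chi hq) (F k) :=
  ⟨isSelfAdjoint_F k, F_mul_self k, lift_mem_of_isClosed (isSUq2Matrix_chiMatrix hq)
    (isClosed_essentialCommutant (F k)) (chiMatrix_mem_essentialCommutant hq k)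
    (star_chiMatrix_mem_essentialCommutant hq k)⟩

end FredholmModule

section PowerLimit

open Filter Topology

theorem mul_eq_right_of_tendsto_pow {M : Type*} [Monoid M] [TopologicalSpace M] [T2Space M]
    [SeparatelyContinuousMul M] {x r : M} (h : Tendsto (x ^ ·) atTop (𝓝 r)) : x * r = r := by
  refine tendsto_nhds_unique (h.const_mul x) ?_
  simpa only [Function.comp_def, pow_succ'] using h.comp (tendsto_add_atTop_nat 1)

theorem isIdempotentElem_of_tendsto_pow {M : Type*} [Monoid M] [TopologicalSpace M] [T2Space M]
    [SeparatelyContinuousMul M] {x r : M} (h : Tendsto (x ^ ·) atTop (𝓝 r)) :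
    IsIdempotentElem r := by
  have hpow (j : ℕ) : x ^ j * r = r := by
    induction j with
    | zero => rw [pow_zero, one_mul]
    | succ j ih => rw [pow_succ, mul_assoc, mul_eq_right_of_tendsto_pow h, ih]
  refine tendsto_nhds_unique (h.mul_const r) ?_
  simpa only [hpow] using tendsto_const_nhds

theorem commute_of_tendsto_pow {M : Type*} [Monoid M] [TopologicalSpace M] [T2Space M]
    [SeparatelyContinuousMul M] {x r z : M} (h : Tendsto (x ^ ·) atTop (𝓝 r))
    (hz : Commute z x) : Commute z r :=
  tendsto_nhds_unique (h.const_mul z) <|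
    (h.mul_const z).congr fun j => ((hz.pow_right j).eq).symm

theorem isStarProjection_of_tendsto_pow {M : Type*} [Monoid M] [StarMul M] [TopologicalSpace M]
    [T2Space M] [SeparatelyContinuousMul M] [ContinuousStar M] {x r : M}
    (h : Tendsto (x ^ ·) atTop (𝓝 r)) (hx : IsSelfAdjoint x) : IsStarProjection r where
  isIdempotentElem := isIdempotentElem_of_tendsto_pow h
  isSelfAdjoint := tendsto_nhds_unique h.star (h.congr fun j => ((hx.pow j).star_eq).symm)

end PowerLimit

theorem mul_add_one_sub_mem_unitary {R : Type*} [Ring R] [StarRing R] {z r : R}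
    (hr : IsStarProjection r) (hzr : Commute z r) (hleft : star z * z * r = r)
    (hright : z * star z * r = r) : z * r + 1 - r ∈ unitary R := by
  have hzr' : Commute (star z) r := by
    simpa only [hr.isSelfAdjoint.star_eq] using hzr.star_star
  have hinv {a b : R} (hb : Commute b r) (hab : a * b * r = r) :
      (a * r + 1 - r) * (b * r + 1 - r) = 1 := by
    have hrr : r * r = r := hr.isIdempotentElem
    have hrbr : r * (b * r) = b * r := by rw [hb.eq, ← mul_assoc, hrr]
    have harbr : a * r * (b * r) = r := by rw [mul_assoc, hrbr, ← mul_assoc, hab]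
    have harr : a * r * r = a * r := by rw [mul_assoc, hrr]
    calc (a * r + 1 - r) * (b * r + 1 - r)
        = a * r * (b * r) + (a * r - a * r * r) + (b * r - r * (b * r)) + 1 - r - r + r * r := by
          noncomm_ring
      _ = 1 := by rw [harbr, hrbr, harr, hrr]; noncomm_ring
  have hstar : star (z * r + 1 - r) = star z * r + 1 - r := by
    rw [star_sub, star_add, star_mul, hr.isSelfAdjoint.star_eq, star_one, hzr'.eq]
  rw [Unitary.mem_iff, hstar]
  exact ⟨hinv hzr hleft, hinv hzr' hright⟩

section Relations

variable {q : ℝ} {B : Type*} [CStarAlgebra B] {u : Matrix (Fin 2) (Fin 2) B}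

theorem IsSUq2Matrix.star_00_mul_self (h : IsSUq2Matrix q u) :
    star (u 0 0) * u 0 0 = 1 - star (u 1 0) * u 1 0 := by
  have hcol := h.col 0 0
  rw [Fin.sum_univ_two, if_pos rfl] at hcol
  exact eq_sub_of_add_eq hcol

theorem IsSUq2Matrix.apply_01_eq (h : IsSUq2Matrix q u) (hq : q ≠ 0) :
    u 0 1 = -((q : ℂ) • star (u 1 0)) := by
  rw [h.star_10 hq, smul_neg, smul_inv_smul₀ (Complex.ofReal_ne_zero.2 hq), neg_neg]

theorem IsSUq2Matrix.mul_star_self_00 (h : IsSUq2Matrix q u) (hq : q ≠ 0) :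
    u 0 0 * star (u 0 0) = 1 - (q : ℂ) ^ 2 • (star (u 1 0) * u 1 0) := by
  have hrow := h.row 0 0
  rw [Fin.sum_univ_two, if_pos rfl, h.star_01 hq, h.apply_01_eq hq, neg_mul_neg,
    smul_mul_smul_comm, ← pow_two] at hrow
  exact eq_sub_of_add_eq hrow

theorem IsSUq2Matrix.mul_star_self_10 (h : IsSUq2Matrix q u) (hq : q ≠ 0) :
    u 1 0 * star (u 1 0) = star (u 1 0) * u 1 0 := by
  have hcol := h.col 1 1
  rw [Fin.sum_univ_two, if_pos rfl, h.star_01 hq, h.apply_01_eq hq, h.star_11 hq,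
    ← h.star_00 hq, h.mul_star_self_00 hq, neg_mul_neg, smul_mul_smul_comm, ← pow_two] at hcol
  refine smul_right_injective B (pow_ne_zero 2 (Complex.ofReal_ne_zero.2 hq)) ?_
  beta_reduce
  rw [eq_sub_of_add_eq hcol, sub_sub_cancel]

theorem IsSUq2Matrix.pow_mul_star_00 (h : IsSUq2Matrix q u) (hq : q ≠ 0) (j : ℕ) :
    (star (u 1 0) * u 1 0) ^ j * star (u 0 0) =
      ((q : ℂ) ^ 2) ^ j • (star (u 0 0) * (star (u 1 0) * u 1 0) ^ j) := by
  have hbase : star (u 1 0) * u 1 0 * star (u 0 0) =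
      (q : ℂ) ^ 2 • (star (u 0 0) * (star (u 1 0) * u 1 0)) := by
    have hassoc := mul_assoc (star (u 0 0)) (u 0 0) (star (u 0 0))
    rw [h.star_00_mul_self, h.mul_star_self_00 hq, sub_mul, one_mul, mul_sub, mul_one,
      mul_smul_comm] at hassoc
    exact sub_right_injective hassoc
  induction j with
  | zero => simp
  | succ j ih =>
    rw [pow_succ', mul_assoc, ih, mul_smul_comm, ← mul_assoc, hbase, smul_mul_assoc, smul_smul,
      ← pow_succ, mul_assoc]

/- Since `1 - x = a⋆ a` for `x = c⋆ c`, the commutation rule `x a⋆ = q² a⋆ x` gives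
`‖x ^ j - x ^ (j + 1)‖ = ‖x ^ j a⋆ a‖ = q ^ (2 j) ‖a⋆ x ^ j a‖ ≤ q ^ (2 j)`. -/
theorem IsSUq2Matrix.cauchySeq_pow (h : IsSUq2Matrix q u) (hq : q ∈ Set.Ioo (0 : ℝ) 1) :
    CauchySeq ((star (u 1 0) * u 1 0) ^ ·) := by
  have hx : ‖star (u 1 0) * u 1 0‖ ≤ 1 := by
    rw [CStarRing.norm_star_mul_self]
    exact mul_le_one₀ (h.norm_entry_le 1 0) (norm_nonneg _) (h.norm_entry_le 1 0)
  have hpow (j : ℕ) : ‖(star (u 1 0) * u 1 0) ^ j * u 0 0‖ ≤ 1 := by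
    induction j with
    | zero => simpa using h.norm_entry_le 0 0
    | succ j ih =>
      rw [pow_succ', mul_assoc]
      exact (norm_mul_le _ _).trans (mul_le_one₀ hx (norm_nonneg _) ih)
  refine cauchySeq_of_le_geometric (q ^ 2) 1 (pow_lt_one₀ hq.1.le hq.2 two_ne_zero) fun j => ?_
  have hdiff : (star (u 1 0) * u 1 0) ^ j - (star (u 1 0) * u 1 0) ^ (j + 1) =
      ((q : ℂ) ^ 2) ^ j • (star (u 0 0) * ((star (u 1 0) * u 1 0) ^ j * u 0 0)) := by
    rw [pow_succ, ← mul_one_sub, ← h.star_00_mul_self, ← mul_assoc, h.pow_mul_star_00 hq.1.ne',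
      smul_mul_assoc, mul_assoc]
  rw [dist_eq_norm, hdiff, norm_smul, norm_pow, norm_pow, Complex.norm_real,
    Real.norm_of_nonneg hq.1.le, mul_comm]
  gcongr
  refine (norm_mul_le _ _).trans (mul_le_one₀ ?_ (norm_nonneg _) (hpow j))
  rw [norm_star]
  exact h.norm_entry_le 0 0

end Relations

theorem continuous_lift {q : ℝ} {B : Type} [CStarAlgebra B] [Nontrivial B]
    (u : Matrix (Fin 2) (Fin 2) B) (hu : IsSUq2Matrix q u) : Continuous (lift u hu) :=
  (lp.evalCLM ℂ (fun ρ : Realization q => ρ.B) ∞ ⟨B, u, hu⟩).continuous.comp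
    continuous_subtype_val

section SpectralProjection

open Filter Topology

variable {q : ℝ} (hq : q ∈ Set.Ioo (0 : ℝ) 1)

theorem star_chiMatrix_10_mul_self_pow_apply (j : ℕ) (x : Hil) (n : ℤ) (m : ℕ) :
    ((star (chiMatrix hq 1 0) * chiMatrix hq 1 0) ^ j) x (n, m) =
      ((q : ℂ) ^ (2 * m)) ^ j * x (n, m) := by
  induction j with
  | zero => simp
  | succ j ih =>
    rw [pow_succ']
    change star (chiMatrix hq 1 0) (chiMatrix hq 1 0
      (((star (chiMatrix hq 1 0) * chiMatrix hq 1 0) ^ j) x)) (n, m) = _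
    rw [star_chiMatrix_10_apply, chiMatrix_10_apply, sub_add_cancel, ih]
    ring

theorem eq_pOp_of_tendsto_pow {r : Hil →L[ℂ] Hil}
    (h : Tendsto ((star (chiMatrix hq 1 0) * chiMatrix hq 1 0) ^ ·) atTop (𝓝 r)) : r = pOp := by
  ext x ⟨n, m⟩
  have hlim := ((lp.evalCLM ℂ (fun _ : ℤ × ℕ => ℂ) 2 (n, m) ∘L
    ContinuousLinearMap.apply ℂ Hil x).continuous.tendsto r).comp h
  refine tendsto_nhds_unique (hlim.congr fun j =>
    star_chiMatrix_10_mul_self_pow_apply hq j x n m) ?_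
  rw [pOp_apply]
  split_ifs with hm
  · simp [hm]
  · have hlt : ‖(q : ℂ) ^ (2 * m)‖ < 1 := by
      rw [norm_pow, Complex.norm_real, Real.norm_of_nonneg hq.1.le]
      exact pow_lt_one₀ hq.1.le hq.2 (by lia)
    simpa using (tendsto_pow_atTop_nhds_zero_of_norm_lt_one hlt).mul_const (x (n, m))

theorem chiMatrix_10_mul_pOp : chiMatrix hq 1 0 * pOp = tOp * pOp := by
  ext x ⟨n, m⟩
  change chiMatrix hq 1 0 (pOp x) (n, m) = tOp (pOp x) (n, m)
  rw [chiMatrix_10_apply, tOp_apply, pOp_apply]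
  split_ifs with hm
  · rw [hm, pow_zero, one_mul]
  · rw [mul_zero]

theorem exists_unitary_chi_eq :
    ∃ v : unitary (Matrix (Fin 1) (Fin 1) (CSUq2 q)),
      chi hq (v.1 0 0) = tOp * pOp + 1 - pOp := by
  have hu := isSUq2Matrix_gen q
  have hnormal := hu.mul_star_self_10 hq.1.ne'
  obtain ⟨r, hr⟩ := cauchySeq_tendsto_of_complete (hu.cauchySeq_pow hq)
  have hright := mul_eq_right_of_tendsto_pow hr
  have hunitary : gen q 1 0 * r + 1 - r ∈ unitary (CSUq2 q) :=
    mul_add_one_sub_mem_unitary (isStarProjection_of_tendsto_pow hr (.star_mul_self _))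
      (commute_of_tendsto_pow hr (by rw [Commute, SemiconjBy, ← mul_assoc, hnormal]))
      hright (by rw [hnormal, hright])
  have hchi : chi hq r = pOp := by
    refine eq_pOp_of_tendsto_pow hq ?_
    have hcont := continuous_lift (chiMatrix hq) (isSUq2Matrix_chiMatrix hq)
    refine ((hcont.tendsto r).comp hr).congr fun j => ?_
    rw [Function.comp_apply, map_pow, map_mul, map_star]
    rfl
  refine ⟨⟨Matrix.of fun _ _ => gen q 1 0 * r + 1 - r, ?_⟩, ?_⟩
  · rw [Unitary.mem_iff] at hunitary ⊢
    constructor <;> ext1 i j <;>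
      rw [Matrix.mul_apply, Fin.sum_univ_one, Subsingleton.elim i j, Matrix.one_apply_eq]
    exacts [hunitary.1, hunitary.2]
  · change chi hq (gen q 1 0 * r + 1 - r) = _
    rw [map_sub, map_add, map_mul, map_one, hchi]
    exact congrArg (· + 1 - pOp) (chiMatrix_10_mul_pOp hq)

end SpectralProjection

end QuantumSU2

open QuantumSU2 in
theorem mainTheorem6 (q : ℝ) (hq : q ∈ Set.Ioo (0 : ℝ) 1) (k : ℤ) :
    IsOddFredholmModule (chi hq) (F k) ∧
    ((compression (chi hq) (F k) (fundamentalUnitary q)).IsFredholm ∧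
      indexPairing (chi hq) (F k) (fundamentalUnitary q) = -1) ∧
    ∃ v : unitary (Matrix (Fin 1) (Fin 1) (CSUq2 q)),
      chi hq (v.1 0 0) = tOp * pOp + 1 - pOp ∧
      (compression (chi hq) (F k) v).IsFredholm ∧
      indexPairing (chi hq) (F k) v = -1 := by
  obtain ⟨v, hv⟩ := exists_unitary_chi_eq hq
  exact ⟨isOddFredholmModule_chi hq k, isFredholm_and_indexPairing_fundamentalUnitary hq k, v, hv,
    isFredholm_and_indexPairing_of_eq hv k⟩
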